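/- Let $M$ be a closed connected orientable surface of genus $g$ with $n$ marked points $p_1,\dots,p_n$, where $2-2g-n<0$, and let $S=\{p_1,\dots,p_n\}$. A dilation structure $\Sigma$ on $(M,S)$ is an atlas on $M\setminus S$ with values in $\mathbb{C}$ whose transition maps are locally of the form $z\mapsto az+b$ with $a>0$ real and $b\in\mathbb{C}$, such that every $s\in S$ is a conical-dilation singularity: for some integer $k\ge 1$ and some $\lambda>0$, a punctured neighbourhood of $s$ is isomorphic to a punctured neighbourhood of the apex in the quotient of the universal cover $\widetilde{\mathbb{C}^*}$ (with coordinate $w=\log z$ and developing map $\exp$) by $w\mapsto w+\log\lambda+2i\pi k$. Let $\mathcal{MD}_{g,n}$ be the set of such structures, up to isomorphism, that admit a geodesic triangulation, i.e. a triangulation (in the sense of gluings of finitely many Euclidean triangles, in which edges or vertices of the same triangle may be identified) whose edges are geodesic segments and whose set of vertices is exactly $S$. A dilation cylinder of angle $\theta>0$ and multiplier $\rho>1$ is the quotient of an open angular sector of angle $\theta$ with apex $0$ by $z\mapsto\rho z$. Let $\Theta(\Sigma)$ be the supremum of the angles of the dilation cylinders embedded in $M\setminus S$ by a map preserving the dilation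 structures ($\Theta(\Sigma)=0$ if there are none). For $t\in\mathbb{R}$, let $g_t\cdot\Sigma$ be the structure obtained by composing every chart of $\Sigma$ with the linear map $\begin{pmatrix}e^t&0\\0&e^{-t}\end{pmatrix}$ of $\mathbb{C}=\mathbb{R}^2$ (Teichmüller flow). For $\theta\in S^1=\mathbb{R}/2\pi\mathbb{Z}$, the foliation of $\Sigma$ in direction $\theta$ is the foliation of $M\setminus S$ by the oriented straight lines of direction $e^{i\theta}$. A closed leaf in $M\setminus S$ is hyperbolic if the first return map of the foliation to a small segment transverse to the leaf is contracting or dilating near the leaf. Let $\mathcal{C}_\Sigma\subset S^1$ be the set of directions $\theta$ such that the foliation in direction $\theta$ has no hyperbolic closed leaf. A point $x\in S^1$ is a density point of $A\subset S^1$ if $\mathrm{Leb}(A\cap B(x,r))/\mathrm{Leb}(B(x,r))\to 1$ as $r\to 0^+$. **Statement.** Let $\Sigma\in\mathcal{MD}_{g,n}$. If $\Theta(g_t\cdot\Sigma)$ does not tend to $0$ as $t\to+\infty$, then the vertical direction $\frac{\pi}{2}$ is not a density point of $\mathcal{C}_\Sigma$. -/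

import Mathlib

open Set Filter Topology MeasureTheory

noncomputable section

namespace Dilation

/-- A dilation atlas on `M \ S`: charts with values in `ℂ` whose domains cover `M \ S` and whose
transition maps are locally of the form `z ↦ a z + b` with `a > 0` real and `b ∈ ℂ`. -/
structure DilationAtlas (M : Type*) [TopologicalSpace M] (S : Set M) where
  atlas : Set (OpenPartialHomeomorph M ℂ)
  source_subset : ∀ e ∈ atlas, e.source ⊆ Sᶜ
  covers : ∀ x ∉ S, ∃ e ∈ atlas, x ∈ e.source
  compatible : ∀ e ∈ atlas, ∀ e' ∈ atlas, ∀ x ∈ e.source ∩ e'.source,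
    ∃ (a : ℝ) (b : ℂ), 0 < a ∧ ∀ᶠ y in 𝓝 x, e' y = a * e y + b

/-- The linear action of `SL₂(ℝ)` on the plane `ℂ = ℝ²`. -/
def planeHomeo (A : Matrix.SpecialLinearGroup (Fin 2) ℝ) : ℂ ≃ₜ ℂ where
  toFun z := ⟨A 0 0 * z.re + A 0 1 * z.im, A 1 0 * z.re + A 1 1 * z.im⟩
  invFun z := ⟨A 1 1 * z.re - A 0 1 * z.im, -A 1 0 * z.re + A 0 0 * z.im⟩
  left_inv z := by
    have h := A.det_coe
    rw [Matrix.det_fin_two] at h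
    apply Complex.ext <;> simp only
    · linear_combination z.re * h
    · linear_combination z.im * h
  right_inv z := by
    have h := A.det_coe
    rw [Matrix.det_fin_two] at h
    apply Complex.ext <;> simp only
    · linear_combination z.re * h
    · linear_combination z.im * h
  continuous_toFun := by
    have : (fun z : ℂ => (⟨A 0 0 * z.re + A 0 1 * z.im, A 1 0 * z.re + A 1 1 * z.im⟩ : ℂ)) =
        fun z : ℂ => ((A 0 0 * z.re + A 0 1 * z.im : ℝ) : ℂ) +
          ((A 1 0 * z.re + A 1 1 * z.im : ℝ) : ℂ) * Complex.I := by
      funext z; apply Complex.ext <;> simp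
    rw [this]; fun_prop
  continuous_invFun := by
    have : (fun z : ℂ => (⟨A 1 1 * z.re - A 0 1 * z.im, -A 1 0 * z.re + A 0 0 * z.im⟩ : ℂ)) =
        fun z : ℂ => ((A 1 1 * z.re - A 0 1 * z.im : ℝ) : ℂ) +
          ((-A 1 0 * z.re + A 0 0 * z.im : ℝ) : ℂ) * Complex.I := by
      funext z; apply Complex.ext <;> simp
    rw [this]; fun_prop

theorem planeHomeo_affine (A : Matrix.SpecialLinearGroup (Fin 2) ℝ) (a : ℝ) (z b : ℂ) :
    planeHomeo A (a * z + b) = a * planeHomeo A z + planeHomeo A b := by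
  apply Complex.ext <;> simp [planeHomeo] <;> ring

/-- The diagonal matrix with entries `e ^ t` and `e ^ (-t)`. -/
def teichmullerMatrix (t : ℝ) : Matrix.SpecialLinearGroup (Fin 2) ℝ :=
  ⟨!![Real.exp t, 0; 0, Real.exp (-t)], by
    rw [Matrix.det_fin_two_of, ← Real.exp_add]; simp⟩

/-- Directions, that is points of `S¹ = ℝ / 2πℤ`. -/
abbrev Direction : Type := AddCircle (2 * Real.pi)

instance factTwoPiPos : Fact (0 < 2 * Real.pi) := ⟨Real.two_pi_pos⟩

/-- The unit vector `e ^ (i θ)`. -/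
def unitVector (θ : Direction) : ℂ := (AddCircle.toCircle θ : ℂ)

/-- The open sector `{α < arg < β}` seen on the universal cover of `ℂ \ {0}`, in the coordinate
`w = log z`; its angle `β - α` may exceed `2π`. -/
def logSector (α β : ℝ) : Set ℂ := {w | α < w.im ∧ w.im < β}

/-- The translation `w ↦ w + log lam + 2πik` of `ℂ`, the universal cover of `ℂ \ {0}` via `exp`,
generates the group whose quotient is the cone of angle `2πk` and dilation factor `lam`. -/
def conePeriod (k : ℕ) (lam : ℝ) : ℂ := Real.log lam + 2 * Real.pi * k * Complex.I

/-- A linear form that is invariant under translation by `conePeriod k lam` and that tends to `-∞`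
exactly when one approaches the apex of the cone. -/
def coneHeight (k : ℕ) (lam : ℝ) (w : ℂ) : ℝ := 2 * Real.pi * k * w.re - Real.log lam * w.im

/-- The subset of the universal cover of the punctured cone that lies over a punctured
neighbourhood of the apex. -/
def coneNhd (k : ℕ) (lam R : ℝ) : Set ℂ := {w | coneHeight k lam w < R}

namespace DilationAtlas

variable {M : Type*} [TopologicalSpace M] {S : Set M}

/-- The action of `SL₂(ℝ)`: every chart is composed with the linear map `A`. -/
def sl2 (A : Matrix.SpecialLinearGroup (Fin 2) ℝ) (D : DilationAtlas M S) :
    DilationAtlas M S where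
  atlas := (fun e => e.transHomeomorph (planeHomeo A)) '' D.atlas
  source_subset := by
    rintro _ ⟨e, he, rfl⟩
    exact D.source_subset e he
  covers := by
    intro x hx
    obtain ⟨e, he, hxe⟩ := D.covers x hx
    exact ⟨_, ⟨e, he, rfl⟩, hxe⟩
  compatible := by
    rintro _ ⟨e, he, rfl⟩ _ ⟨e', he', rfl⟩ x hx
    obtain ⟨a, b, ha, h⟩ := D.compatible e he e' he' x hx
    refine ⟨a, planeHomeo A b, ha, ?_⟩
    filter_upwards [h] with y hy
    change planeHomeo A (e' y) = a * planeHomeo A (e y) + planeHomeo A b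
    rw [hy, planeHomeo_affine]

/-- The Teichmüller flow `g_t`. -/
def teichmullerFlow (t : ℝ) (D : DilationAtlas M S) : DilationAtlas M S :=
  D.sl2 (teichmullerMatrix t)

/-- `ψ : V → M \ S` is continuous and locally a dilation map, where `V ⊆ ℂ` carries the dilation
structure with developing map `f`: in every chart, `ψ` reads locally as `a f + b` with `a > 0`. -/
def IsDilationMapOn (D : DilationAtlas M S) (f : ℂ → ℂ) (V : Set ℂ) (ψ : ℂ → M) : Prop :=
  ContinuousOn ψ V ∧ ∀ w ∈ V, ψ w ∉ S ∧ ∀ e ∈ D.atlas, ψ w ∈ e.source →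
    ∃ (a : ℝ) (b : ℂ), 0 < a ∧ ∀ᶠ w' in 𝓝[V] w, e (ψ w') = a * f w' + b

/-- The structure extends to `s` as a conical-dilation singularity of angle `2πk` and dilation
factor `lam`: a punctured neighbourhood of `s` is isomorphic, as a dilation surface, to a punctured
neighbourhood of the apex in the quotient of the universal cover of `ℂ \ {0}` by
`w ↦ w + conePeriod k lam`. -/
def IsConicalAt (D : DilationAtlas M S) (s : M) (k : ℕ) (lam : ℝ) : Prop :=
  ∃ (R : ℝ) (φ : ℂ → M),
    D.IsDilationMapOn Complex.exp (coneNhd k lam R) φ ∧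
    (∀ w ∈ coneNhd k lam R, ∀ w' ∈ coneNhd k lam R,
      φ w = φ w' ↔ ∃ m : ℤ, w' = w + m * conePeriod k lam) ∧
    Tendsto φ (comap (coneHeight k lam) atBot) (𝓝 s) ∧
    ∀ r ≤ R, insert s (φ '' coneNhd k lam r) ∈ 𝓝 s

/-- Every point of `S` is a conical-dilation singularity of angle `2πk`, `k ≥ 1`, and of dilation
factor `lam > 0`. -/
def IsDilationStructure (D : DilationAtlas M S) : Prop :=
  ∀ s ∈ S, ∃ (k : ℕ) (lam : ℝ), 1 ≤ k ∧ 0 < lam ∧ D.IsConicalAt s k lam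

/-- `M` is obtained from finitely many nondegenerate Euclidean triangles `T i` glued along their
edges, by maps `σ i` from the closed triangles to `M` that preserve the dilation structure away
from the vertices, the set of vertices being exactly `S`. As in the theory of flat surfaces, edges
or vertices of one triangle may be identified with each other. Since vertices go to `S` and all
other points go to the complement of `S`, triangles whose interiors are embedded and disjoint are
automatically glued edge to edge, and edges are geodesic segments. -/
def HasGeodesicTriangulation (D : DilationAtlas M S) : Prop :=
  ∃ (m : ℕ) (T : Fin m → Fin 3 → ℂ) (σ : Fin m → ℂ → M),
    (∀ i, AffineIndependent ℝ (T i)) ∧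
    (∀ i, ContinuousOn (σ i) (convexHull ℝ (range (T i)))) ∧
    (∀ i v, σ i (T i v) ∈ S) ∧
    (∀ i, D.IsDilationMapOn id (convexHull ℝ (range (T i)) \ range (T i)) (σ i)) ∧
    (∀ i j, ∀ z ∈ interior (convexHull ℝ (range (T i))),
      ∀ w ∈ interior (convexHull ℝ (range (T j))), σ i z = σ j w → i = j ∧ z = w) ∧
    ∀ x : M, ∃ i, ∃ z ∈ convexHull ℝ (range (T i)), σ i z = x

/-- `M \ S` contains an embedded dilation cylinder, the quotient of the sector of angles between
`α` and `β` by the dilation of factor `ρ > 1`. -/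
def ContainsCylinder (D : DilationAtlas M S) (α β ρ : ℝ) : Prop :=
  α < β ∧ 1 < ρ ∧ ∃ ψ : ℂ → M,
    D.IsDilationMapOn Complex.exp (logSector α β) ψ ∧
    ∀ w ∈ logSector α β, ∀ w' ∈ logSector α β,
      ψ w = ψ w' ↔ ∃ m : ℤ, w' = w + m * (Real.log ρ : ℂ)

/-- `Θ`: the supremum of the angles of the embedded dilation cylinders (`0` if there are none). -/
def Theta (D : DilationAtlas M S) : ENNReal :=
  ⨆ (α : ℝ) (β : ℝ) (ρ : ℝ) (_ : D.ContainsCylinder α β ρ), ENNReal.ofReal (β - α)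

/-- The curve `c`, on the set `I` of parameters, runs in `M \ S` along a leaf of the directional
foliation in direction `θ`, in the positive sense (with an arbitrary monotone parametrization). -/
def IsLeafCurve (D : DilationAtlas M S) (θ : Direction) (I : Set ℝ) (c : ℝ → M) : Prop :=
  ContinuousOn c I ∧ ∀ t ∈ I, c t ∉ S ∧ ∀ e ∈ D.atlas, c t ∈ e.source →
    ∃ u ∈ 𝓝[I] t, ∀ t₁ ∈ u, ∀ t₂ ∈ u, t₁ < t₂ →
      ∃ r : ℝ, 0 < r ∧ e (c t₂) = e (c t₁) + r * unitVector θ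

/-- `γ` parametrizes, with period `T`, a regular closed leaf in direction `θ`. -/
def IsClosedLeaf (D : DilationAtlas M S) (θ : Direction) (γ : ℝ → M) (T : ℝ) : Prop :=
  0 < T ∧ Function.Periodic γ T ∧ InjOn γ (Ico 0 T) ∧ D.IsLeafCurve θ univ γ

/-- `P` is, on `]-δ, δ[`, the first return map of the foliation in direction `θ` to the segment
`τ (]-ε, ε[)`. -/
def IsFirstReturnMap (D : DilationAtlas M S) (θ : Direction) (τ : ℝ → M) (ε δ : ℝ)
    (P : ℝ → ℝ) : Prop :=
  ∀ s : ℝ, |s| < δ → |P s| < ε ∧ ∃ c : ℝ → M,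
    D.IsLeafCurve θ (Icc 0 1) c ∧ c 0 = τ s ∧ c 1 = τ (P s) ∧
    ∀ t ∈ Ioo (0 : ℝ) 1, ∀ s' : ℝ, |s'| < ε → c t ≠ τ s'

/-- The straight segment through `x`, orthogonal to the direction `θ`, in the chart `e`. -/
def transversal (e : OpenPartialHomeomorph M ℂ) (x : M) (θ : Direction) (s : ℝ) : M :=
  e.symm (e x + s * (Complex.I * unitVector θ))

/-- The closed leaf `γ` is hyperbolic: on a small transverse segment through `γ 0`, the first
return map (which fixes `γ 0`) is contracting or dilating. -/
def IsHyperbolicLeaf (D : DilationAtlas M S) (θ : Direction) (γ : ℝ → M) : Prop :=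
  ∃ e ∈ D.atlas, γ 0 ∈ e.source ∧ ∃ (ε δ : ℝ) (P : ℝ → ℝ), 0 < δ ∧ δ ≤ ε ∧
    (∀ s : ℝ, |s| < ε → e (γ 0) + s * (Complex.I * unitVector θ) ∈ e.target) ∧
    D.IsFirstReturnMap θ (transversal e (γ 0) θ) ε δ P ∧ P 0 = 0 ∧
    ((∃ κ : ℝ, κ < 1 ∧ ∀ s s' : ℝ, |s| < δ → |s'| < δ → |P s - P s'| ≤ κ * |s - s'|) ∨
     (∃ κ : ℝ, 1 < κ ∧ ∀ s s' : ℝ, |s| < δ → |s'| < δ → κ * |s - s'| ≤ |P s - P s'|))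

/-- `𝒞_Σ`: the directions whose foliation has no hyperbolic (regular) closed leaf. -/
def nonHyperbolicDirections (D : DilationAtlas M S) : Set Direction :=
  {θ | ¬ ∃ (γ : ℝ → M) (T : ℝ), D.IsClosedLeaf θ γ T ∧ D.IsHyperbolicLeaf θ γ}

end DilationAtlas

/-- The closed connected orientable surface `M` has genus `g`: its first homology group
`H₁(M, ℤ)`, the abelianized fundamental group, has rank `2g`. -/
def HasGenus (M : Type*) [TopologicalSpace M] (g : ℕ) : Prop :=
  ∀ x : M, Module.finrank ℤ (Additive (Abelianization (FundamentalGroup M x))) = 2 * g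

/-- The dilation atlas `D` on the closed connected surface `M` with marked points
`p 0, …, p (n - 1)` represents a point of the moduli space `ℳ𝒟_{g,n}`. Orientability of `M` follows
from the existence of `D`. -/
structure RepresentsMD {M : Type*} [TopologicalSpace M] (g n : ℕ) (p : Fin n → M)
    (D : DilationAtlas M (range p)) : Prop where
  euler_neg : 2 < 2 * g + n
  genus : HasGenus M g
  marked_injective : Function.Injective p
  conical : D.IsDilationStructure
  triangulable : D.HasGeodesicTriangulation

/-- `x` is a Lebesgue density point of `A ⊆ S¹`, for the arc length measure. -/
def IsDensityPoint (A : Set Direction) (x : Direction) : Prop :=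
  Tendsto (fun r : ℝ => volume (A ∩ Metric.ball x r) / volume (Metric.ball x r))
    (𝓝[>] 0) (𝓝 1)

end Dilation

end

/-!
A dilation cylinder is the quotient of a plane sector by `z ↦ ρ z`. Each half-line of the sector
closes up to a leaf, and sliding a transverse segment once along this leaf rescales it by `ρ`, so
every direction of the sector, and its opposite, has a hyperbolic closed leaf. If `g_t Σ` contains a
cylinder of angle at least `δ`, these directions cover a range of slopes, measured from the
vertical, that lies in a fixed interval `]-K, K[` and whose length is bounded below in terms of `δ`.
Going back to `Σ` multiplies these slopes by `e ^ (-2t)`, which gives an arc of directions with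
hyperbolic closed leaves whose length is comparable to the radius `K e ^ (-2t)` of a ball about the
vertical that contains it. When this happens for arbitrarily large `t`, the vertical is not a
density point of the complement.
-/

namespace Dilation

theorem unitVector_ne_zero (θ : Direction) : unitVector θ ≠ 0 := Circle.coe_ne_zero _

theorem unitVector_coe (x : ℝ) : unitVector (x : Direction) = Complex.exp (x * Complex.I) := by
  rw [unitVector, AddCircle.toCircle_apply_mk, Circle.coe_exp, div_self Real.two_pi_pos.ne',
    one_mul]

theorem planeHomeo_smul (A : Matrix.SpecialLinearGroup (Fin 2) ℝ) (a : ℝ) (z : ℂ) :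
    planeHomeo A (a • z) = a • planeHomeo A z := by
  apply Complex.ext <;> simp [planeHomeo] <;> ring

theorem zpow_notMem_uIoo_one {ρ : ℝ} (hρ : 0 < ρ) (m : ℤ) : ρ ^ m ∉ uIoo 1 ρ := by
  intro h
  suffices 0 < m ∧ m < 1 by lia
  rcases lt_trichotomy ρ 1 with hlt | rfl | hgt
  · rw [uIoo_of_gt hlt] at h
    rw [← zpow_lt_zpow_iff_right_of_lt_one₀ hρ hlt, ← zpow_lt_zpow_iff_right_of_lt_one₀ hρ hlt,
      zpow_zero, zpow_one]
    exact h.symm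
  · simp at h
  · rw [uIoo_of_lt hgt] at h
    rw [← zpow_lt_zpow_iff_right₀ hgt, ← zpow_lt_zpow_iff_right₀ hgt, zpow_zero, zpow_one]
    exact h

theorem rpow_sub_rpow_div_sub_one_pos {ρ t₁ t₂ : ℝ} (hρ : 0 < ρ) (hρ1 : ρ ≠ 1) (ht : t₁ < t₂) :
    0 < (ρ ^ t₂ - ρ ^ t₁) / (ρ - 1) := by
  rcases hρ1.lt_or_gt with hlt | hgt
  · exact div_pos_of_neg_of_neg (sub_neg.2 (Real.rpow_lt_rpow_of_exponent_gt hρ hlt ht))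
      (sub_neg.2 hlt)
  · exact div_pos (sub_pos.2 (Real.rpow_lt_rpow_of_exponent_lt hgt ht)) (sub_pos.2 hgt)

theorem eventually_forall_add_mul_I_mul_mem {K : Set ℝ} {U : Set ℂ} {v : ℂ} (hK : IsCompact K)
    (hU : IsOpen U) (hKU : ∀ x ∈ K, x • v ∈ U) :
    ∀ᶠ y : ℝ in 𝓝 0, ∀ x ∈ K, ((x : ℂ) + y * Complex.I) * v ∈ U := by
  refine hK.eventually_forall_of_forall_eventually fun x hx => ?_
  have hcont : Continuous fun p : ℝ × ℝ => ((p.2 : ℂ) + p.1 * Complex.I) * v := by fun_prop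
  exact hcont.continuousAt.eventually (hU.mem_nhds (by simpa using hKU x hx))

namespace DilationAtlas

variable {M : Type*} [TopologicalSpace M] {S : Set M} {D : DilationAtlas M S}

theorem IsDilationMapOn.isLeafCurve_comp {f : ℂ → ℂ} {V : Set ℂ} {ψ : ℂ → M}
    (hψ : D.IsDilationMapOn f V ψ) {θ : Direction} {I : Set ℝ} {w : ℝ → ℂ}
    (hw : ContinuousOn w I) (hV : MapsTo w I V)
    (hdir : ∀ t₁ ∈ I, ∀ t₂ ∈ I, t₁ < t₂ →
      ∃ r : ℝ, 0 < r ∧ f (w t₂) = f (w t₁) + r * unitVector θ) :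
    D.IsLeafCurve θ I (fun t => ψ (w t)) := by
  refine ⟨hψ.1.comp hw hV, fun t ht => ⟨(hψ.2 _ (hV ht)).1, fun e he hsrc => ?_⟩⟩
  obtain ⟨a, b, ha, hev⟩ := (hψ.2 _ (hV ht)).2 e he hsrc
  have hev' := ((hw t ht).tendsto_nhdsWithin hV).eventually hev
  refine ⟨_, inter_mem hev' self_mem_nhdsWithin, ?_⟩
  rintro t₁ ⟨h₁, hI₁⟩ t₂ ⟨h₂, hI₂⟩ hlt
  obtain ⟨r, hr, hdev⟩ := hdir t₁ hI₁ t₂ hI₂ hlt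
  refine ⟨a * r, mul_pos ha hr, ?_⟩
  rw [mem_ofPred_eq] at h₁ h₂
  rw [h₁, h₂, hdev]
  push_cast
  ring

theorem IsDilationMapOn.exists_transversal_eq {U : Set ℂ} {Ψ : ℂ → M}
    (hΨ : D.IsDilationMapOn id U Ψ) (hU : IsOpen U) {z : ℂ} (hz : z ∈ U) (θ : Direction) :
    ∃ e ∈ D.atlas, Ψ z ∈ e.source ∧ ∃ c : ℝ, 0 < c ∧ ∀ᶠ s : ℝ in 𝓝 0,
      e (Ψ z) + s * (Complex.I * unitVector θ) ∈ e.target ∧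
      transversal e (Ψ z) θ s = Ψ (z + (s * c) • (Complex.I * unitVector θ)) := by
  obtain ⟨e, he, hsrc⟩ := D.covers _ (hΨ.2 z hz).1
  obtain ⟨a, b, ha, hev⟩ := (hΨ.2 z hz).2 e he hsrc
  rw [hU.nhdsWithin_eq hz] at hev
  have hsource : ∀ᶠ w in 𝓝 z, Ψ w ∈ e.source :=
    (hΨ.1.continuousAt (hU.mem_nhds hz)).eventually (e.open_source.mem_nhds hsrc)
  have htend : Tendsto (fun s : ℝ => z + (s * a⁻¹) • (Complex.I * unitVector θ)) (𝓝 0) (𝓝 z) :=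
    Continuous.tendsto' (by fun_prop) _ _ (by simp)
  refine ⟨e, he, hsrc, a⁻¹, inv_pos.2 ha, ?_⟩
  filter_upwards [htend.eventually hev, htend.eventually hsource] with s hchart hs
  have hpoint : e (Ψ z) + s * (Complex.I * unitVector θ) =
      e (Ψ (z + (s * a⁻¹) • (Complex.I * unitVector θ))) := by
    have ha' : (a : ℂ) ≠ 0 := mod_cast ha.ne'
    rw [hchart, hev.self_of_nhds]
    simp only [id, Complex.real_smul, Complex.ofReal_mul, Complex.ofReal_inv]
    field_simp
    ring
  rw [transversal, hpoint, e.left_inv hs]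
  exact ⟨e.map_source hs, rfl⟩

/-- `Ψ` realizes inside `M \ S`, as a dilation surface, the image of the open set `U` in the
quotient of `ℂ \ {0}` by `z ↦ ρ z`. This is the planar description of (a part of) a dilation
cylinder, in which directions are visible; `ρ < 1` is allowed, so that running through the closed
leaves of the cylinder backwards amounts to replacing `ρ` by `ρ⁻¹`. -/
structure IsDilationQuotientMap (D : DilationAtlas M S) (ρ : ℝ) (U : Set ℂ) (Ψ : ℂ → M) :
    Prop where
  isOpen : IsOpen U
  isDilationMapOn : D.IsDilationMapOn id U Ψ
  apply_eq_apply_iff : ∀ z ∈ U, ∀ z' ∈ U, Ψ z = Ψ z' ↔ ∃ m : ℤ, z' = ρ ^ m • z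

namespace IsDilationQuotientMap

variable {ρ : ℝ} {U : Set ℂ} {Ψ : ℂ → M}

theorem inv (h : D.IsDilationQuotientMap ρ U Ψ) : D.IsDilationQuotientMap ρ⁻¹ U Ψ where
  isOpen := h.isOpen
  isDilationMapOn := h.isDilationMapOn
  apply_eq_apply_iff z hz z' hz' := by
    rw [h.apply_eq_apply_iff z hz z' hz', ← (Equiv.neg ℤ).exists_congr_right]
    simp only [Equiv.neg_apply, inv_zpow']

theorem of_sl2 {A : Matrix.SpecialLinearGroup (Fin 2) ℝ}
    (h : (D.sl2 A).IsDilationQuotientMap ρ U Ψ) :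
    D.IsDilationQuotientMap ρ (planeHomeo A ⁻¹' U) (Ψ ∘ planeHomeo A) where
  isOpen := h.isOpen.preimage (planeHomeo A).continuous
  isDilationMapOn := by
    have hA := (planeHomeo A).continuous
    refine ⟨h.isDilationMapOn.1.comp hA.continuousOn (mapsTo_preimage _ _), fun z hz =>
      ⟨(h.isDilationMapOn.2 _ hz).1, fun e he hsrc => ?_⟩⟩
    obtain ⟨a, b, ha, hev⟩ :=
      (h.isDilationMapOn.2 _ hz).2 (e.transHomeomorph (planeHomeo A)) ⟨e, he, rfl⟩ hsrc
    refine ⟨a, (planeHomeo A).symm b, ha, ?_⟩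
    have hpre : Tendsto (planeHomeo A) (𝓝[planeHomeo A ⁻¹' U] z) (𝓝[U] planeHomeo A z) :=
      hA.continuousWithinAt.tendsto_nhdsWithin (mapsTo_preimage _ _)
    refine (hpre.eventually hev).mono fun z' hz' => (planeHomeo A).injective ?_
    rw [planeHomeo_affine, Homeomorph.apply_symm_apply]
    exact hz'
  apply_eq_apply_iff z hz z' hz' := by
    simp only [Function.comp_apply, h.apply_eq_apply_iff _ hz _ hz', ← planeHomeo_smul,
      (planeHomeo A).injective.eq_iff]

variable {θ : Direction} {v : ℂ}

theorem isClosedLeaf (h : D.IsDilationQuotientMap ρ U Ψ) (hρ : 0 < ρ)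
    (hray : ∀ x : ℝ, 0 < x → x • v ∈ U) (hv : unitVector θ = (ρ - 1) • v) :
    D.IsClosedLeaf θ (fun t => Ψ (ρ ^ t • v)) 1 := by
  have hne : (ρ - 1) • v ≠ 0 := hv ▸ unitVector_ne_zero θ
  have hρ1 : ρ ≠ 1 := sub_ne_zero.1 (left_ne_zero_of_smul hne)
  have hmem (t : ℝ) : ρ ^ t • v ∈ U := hray _ (Real.rpow_pos_of_pos hρ t)
  refine ⟨one_pos, fun t => ?_, fun t ht t' ht' heq => ?_,
    h.isDilationMapOn.isLeafCurve_comp ?_ (fun t _ => hmem t) fun t₁ _ t₂ _ hlt =>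
      ⟨_, rpow_sub_rpow_div_sub_one_pos hρ hρ1 hlt, ?_⟩⟩
  · refine ((h.apply_eq_apply_iff _ (hmem t) _ (hmem (t + 1))).2 ⟨1, ?_⟩).symm
    rw [Real.rpow_add_one hρ.ne', zpow_one, smul_smul, mul_comm]
  · obtain ⟨m, hm⟩ := (h.apply_eq_apply_iff _ (hmem t) _ (hmem t')).1 heq
    rw [smul_smul, ← Real.rpow_intCast, ← Real.rpow_add hρ] at hm
    have hexp : t' = m + t :=
      (Real.rpow_right_inj hρ hρ1).1 (smul_left_injective ℝ (right_ne_zero_of_smul hne) hm)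
    have hlt : m < 1 := by exact_mod_cast (by linarith [ht.1, ht'.2] : (m : ℝ) < 1)
    have hgt : -1 < m := by exact_mod_cast (by linarith [ht.2, ht'.1] : (-1 : ℝ) < m)
    obtain rfl : m = 0 := by lia
    simp [hexp]
  · exact ((Real.continuous_const_rpow hρ.ne').smul continuous_const).continuousOn
  · rw [hv, ← Complex.real_smul, smul_smul, div_mul_cancel₀ _ (sub_ne_zero.2 hρ1), id, id,
      ← add_smul, add_sub_cancel]

theorem apply_add_mul_I_mul_ne (h : D.IsDilationQuotientMap ρ U Ψ) (hρ : 0 < ρ) (hv : v ≠ 0)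
    {x y y' : ℝ} (hx : x ∈ uIoo 1 ρ) (hU : ((x : ℂ) + y * Complex.I) * v ∈ U)
    (hU' : (1 + y' * Complex.I) * v ∈ U) :
    Ψ (((x : ℂ) + y * Complex.I) * v) ≠ Ψ ((1 + y' * Complex.I) * v) := by
  intro heq
  obtain ⟨m, hm⟩ := (h.apply_eq_apply_iff _ hU' _ hU).1 heq.symm
  rw [← smul_mul_assoc] at hm
  have hre : x = ρ ^ m := by
    simpa [-Complex.real_smul, Complex.smul_re] using
      congrArg Complex.re (mul_right_cancel₀ hv hm)
  exact zpow_notMem_uIoo_one hρ m (hre ▸ hx)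

/-- The leaf through `(1 + s κ i) v` runs straight to `(ρ + s κ i) v = ρ (1 + (s / ρ) κ i) v`, which
`Ψ` identifies with `(1 + (s / ρ) κ i) v`. -/
theorem isFirstReturnMap (h : D.IsDilationQuotientMap ρ U Ψ) (hρ : 0 < ρ)
    (hv : unitVector θ = (ρ - 1) • v) {κ ε : ℝ} {τ : ℝ → M}
    (hstrip : ∀ s, |s| < ε → ∀ x ∈ uIcc 1 ρ, ((x : ℂ) + (s * κ : ℝ) * Complex.I) * v ∈ U)
    (hτ : ∀ s, |s| < ε → τ s = Ψ ((1 + (s * κ : ℝ) * Complex.I) * v)) :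
    D.IsFirstReturnMap θ τ ε (min ε (ε * ρ)) (fun s => s / ρ) := by
  have hne : (ρ - 1) • v ≠ 0 := hv ▸ unitVector_ne_zero θ
  have hρ1 : ρ ≠ 1 := sub_ne_zero.1 (left_ne_zero_of_smul hne)
  have hbase (s : ℝ) (hs : |s| < ε) : (1 + (s * κ : ℝ) * Complex.I) * v ∈ U := by
    simpa using hstrip s hs 1 left_mem_uIcc
  intro s hs
  have hsε : |s| < ε := hs.trans_le (min_le_left _ _)
  have hsρ : |s / ρ| < ε := by
    rw [abs_div, abs_of_pos hρ, div_lt_iff₀ hρ]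
    exact hs.trans_le (min_le_right _ _)
  have hpath {t : ℝ} (ht : t ∈ Icc (0 : ℝ) 1) : AffineMap.lineMap 1 ρ t ∈ uIcc 1 ρ :=
    segment_eq_uIcc (1 : ℝ) ρ ▸ lineMap_mem_segment ℝ 1 ρ ht
  refine ⟨hsρ, fun t => Ψ (((AffineMap.lineMap 1 ρ t : ℝ) + (s * κ : ℝ) * Complex.I) * v),
    h.isDilationMapOn.isLeafCurve_comp ?_ (fun t ht => hstrip s hsε _ (hpath ht))
      fun t₁ _ t₂ _ hlt => ⟨t₂ - t₁, sub_pos.2 hlt, ?_⟩, ?_, ?_, fun t ht s' hs' heq => ?_⟩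
  · simp only [AffineMap.lineMap_apply, smul_eq_mul, vadd_eq_add, vsub_eq_sub]
    fun_prop
  · rw [hv]
    simp only [AffineMap.lineMap_apply, smul_eq_mul, vadd_eq_add, vsub_eq_sub, id,
      Complex.real_smul]
    push_cast
    ring
  · simp [hτ s hsε]
  · rw [hτ _ hsρ]
    refine ((h.apply_eq_apply_iff _ (hbase _ hsρ) _ (hstrip s hsε _ (hpath (by simp)))).2
      ⟨1, ?_⟩).symm
    have : (ρ : ℂ) ≠ 0 := mod_cast hρ.ne'
    rw [AffineMap.lineMap_apply_one, zpow_one, Complex.real_smul]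
    push_cast
    field_simp
  · exact h.apply_add_mul_I_mul_ne hρ (right_ne_zero_of_smul hne)
      ((openSegment_eq_Ioo' hρ1.symm).subset (lineMap_mem_openSegment ℝ 1 ρ ht))
      (hstrip s hsε _ (hpath (Ioo_subset_Icc_self ht))) (hbase s' hs') (heq.trans (hτ s' hs'))

theorem isHyperbolicLeaf (h : D.IsDilationQuotientMap ρ U Ψ) (hρ : 0 < ρ)
    (hray : ∀ x : ℝ, 0 < x → x • v ∈ U) (hv : unitVector θ = (ρ - 1) • v)
    {γ : ℝ → M} (hγ : γ 0 = Ψ v) : D.IsHyperbolicLeaf θ γ := by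
  have hne : (ρ - 1) • v ≠ 0 := hv ▸ unitVector_ne_zero θ
  have hρ1 : ρ ≠ 1 := sub_ne_zero.1 (left_ne_zero_of_smul hne)
  have hvU : v ∈ U := by simpa using hray 1 one_pos
  obtain ⟨e, he, hsrc, c, -, hτ⟩ := h.isDilationMapOn.exists_transversal_eq h.isOpen hvU θ
  have hκ : Tendsto (fun s : ℝ => s * (c * (ρ - 1))) (𝓝 0) (𝓝 0) :=
    Continuous.tendsto' (by fun_prop) _ _ (by simp)
  have hstrip := hκ.eventually (eventually_forall_add_mul_I_mul_mem (isCompact_uIcc (a := 1))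
    h.isOpen fun x hx => hray x ((lt_min one_pos hρ).trans_le hx.1))
  obtain ⟨ε, hε, hball⟩ := Metric.eventually_nhds_iff.1 (hτ.and hstrip)
  simp only [Real.dist_eq, sub_zero] at hball
  refine ⟨e, he, hγ ▸ hsrc, ε, min ε (ε * ρ), fun s => s / ρ, by positivity, min_le_left _ _,
    fun s hs => hγ ▸ (hball hs).1.1, ?_, zero_div ρ, ?_⟩
  · refine h.isFirstReturnMap hρ hv (fun s hs => (hball hs).2) fun s hs => ?_
    rw [hγ, (hball hs).1.2, hv]
    simp only [Complex.real_smul]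
    push_cast
    ring_nf
  · have hdist (s s' : ℝ) : |s / ρ - s' / ρ| = ρ⁻¹ * |s - s'| := by
      rw [← sub_div, abs_div, abs_of_pos hρ, div_eq_inv_mul]
    rcases hρ1.lt_or_gt with hlt | hgt
    · exact Or.inr ⟨ρ⁻¹, (one_lt_inv₀ hρ).2 hlt, fun s s' _ _ => (hdist s s').ge⟩
    · exact Or.inl ⟨ρ⁻¹, inv_lt_one_of_one_lt₀ hgt, fun s s' _ _ => (hdist s s').le⟩

theorem notMem_nonHyperbolicDirections (h : D.IsDilationQuotientMap ρ U Ψ) (hρ : 1 < ρ)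
    (hray : ∀ x : ℝ, 0 < x → x • v ∈ U) {k : ℝ} (hv : unitVector θ = k • v) :
    θ ∉ D.nonHyperbolicDirections := by
  have hk : k ≠ 0 := left_ne_zero_of_smul (hv ▸ unitVector_ne_zero θ)
  obtain ⟨r, hr, hquot, hkr⟩ : ∃ r : ℝ, 0 < r ∧ D.IsDilationQuotientMap r U Ψ ∧
      0 < k / (r - 1) := by
    have hρ0 : 0 < ρ := one_pos.trans hρ
    rcases hk.lt_or_gt with hneg | hpos
    · exact ⟨ρ⁻¹, inv_pos.2 hρ0, h.inv,
        div_pos_of_neg_of_neg hneg (sub_neg.2 (inv_lt_one_of_one_lt₀ hρ))⟩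
    · exact ⟨ρ, hρ0, h, div_pos hpos (sub_pos.2 hρ)⟩
  have hray' (x : ℝ) (hx : 0 < x) : x • (k / (r - 1)) • v ∈ U := by
    rw [smul_smul]
    exact hray _ (mul_pos hx hkr)
  have hr1 : r - 1 ≠ 0 := fun h0 => by simp [h0] at hkr
  have hv' : unitVector θ = (r - 1) • (k / (r - 1)) • v := by
    rw [smul_smul, mul_div_cancel₀ _ hr1, hv]
  exact fun hmem => hmem ⟨_, 1, hquot.isClosedLeaf hr hray' hv',
    hquot.isHyperbolicLeaf hr hray' hv' (by simp)⟩

end IsDilationQuotientMap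

end DilationAtlas

/-- The branch of the logarithm whose cut is the half-line opposite to `e ^ (i θ₀)` and whose
imaginary part is `θ₀` on the half-line through `e ^ (i θ₀)`. -/
noncomputable def branchLog (θ₀ : ℝ) (z : ℂ) : ℂ :=
  θ₀ * Complex.I + Complex.log (Complex.exp (-θ₀ * Complex.I) * z)

/-- The part of the sector `logSector α β`, projected to the plane, on which `branchLog θ₀` is a
continuous section of the exponential. -/
def branchSector (θ₀ α β : ℝ) : Set ℂ :=
  {z | Complex.exp (-θ₀ * Complex.I) * z ∈ Complex.slitPlane ∧ branchLog θ₀ z ∈ logSector α β}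

section BranchLog

variable {θ₀ α β x ρ : ℝ} {z z' : ℂ}

theorem exp_branchLog (θ₀ : ℝ) (hz : z ≠ 0) : Complex.exp (branchLog θ₀ z) = z := by
  rw [branchLog, Complex.exp_add, Complex.exp_log (mul_ne_zero (Complex.exp_ne_zero _) hz),
    ← mul_assoc, ← Complex.exp_add]
  simp

theorem branchLog_smul (θ₀ : ℝ) (hx : 0 < x) (hz : z ≠ 0) :
    branchLog θ₀ (x • z) = branchLog θ₀ z + Real.log x := by
  rw [branchLog, branchLog, mul_smul_comm, Complex.real_smul,
    Complex.log_ofReal_mul hx (mul_ne_zero (Complex.exp_ne_zero _) hz)]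
  ring

theorem branchLog_exp_ofReal_mul_I (θ₀ : ℝ) :
    branchLog θ₀ (Complex.exp (θ₀ * Complex.I)) = θ₀ * Complex.I := by
  rw [branchLog, ← Complex.exp_add]
  simp

theorem branchLog_eq_add_int_mul_log_iff (hρ : 0 < ρ) (hz : z ≠ 0) (hz' : z' ≠ 0) (m : ℤ) :
    branchLog θ₀ z' = branchLog θ₀ z + m * (Real.log ρ : ℂ) ↔ z' = ρ ^ m • z := by
  have hρm : 0 < ρ ^ m := zpow_pos hρ m
  have hshift : branchLog θ₀ z + m * (Real.log ρ : ℂ) = branchLog θ₀ (ρ ^ m • z) := by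
    rw [branchLog_smul θ₀ hρm hz, Real.log_zpow]
    push_cast
    rfl
  rw [hshift]
  refine ⟨fun h => ?_, congrArg _⟩
  rw [← exp_branchLog θ₀ hz', h, exp_branchLog θ₀ (smul_ne_zero hρm.ne' hz)]

theorem continuousOn_branchLog (θ₀ : ℝ) :
    ContinuousOn (branchLog θ₀) {z | Complex.exp (-θ₀ * Complex.I) * z ∈ Complex.slitPlane} :=
  continuousOn_const.add (ContinuousOn.clog (by fun_prop) fun _ hz => hz)

theorem isOpen_logSector (α β : ℝ) : IsOpen (logSector α β) :=
  (isOpen_lt continuous_const Complex.continuous_im).inter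
    (isOpen_lt Complex.continuous_im continuous_const)

theorem isOpen_branchSector (θ₀ α β : ℝ) : IsOpen (branchSector θ₀ α β) :=
  (continuousOn_branchLog θ₀).isOpen_inter_preimage
    (Complex.isOpen_slitPlane.preimage (continuous_const_mul _)) (isOpen_logSector α β)

theorem ne_zero_of_mem_branchSector (hz : z ∈ branchSector θ₀ α β) : z ≠ 0 :=
  right_ne_zero_of_mul (Complex.slitPlane_ne_zero hz.1)

theorem smul_exp_mem_branchSector (hθ₀ : θ₀ ∈ Ioo α β) (hx : 0 < x) :
    x • Complex.exp (θ₀ * Complex.I) ∈ branchSector θ₀ α β := by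
  constructor
  · rw [mul_smul_comm, ← Complex.exp_add]
    simpa using hx
  · rw [branchLog_smul θ₀ hx (Complex.exp_ne_zero _), branchLog_exp_ofReal_mul_I]
    simpa [logSector] using hθ₀

end BranchLog

namespace DilationAtlas

variable {M : Type*} [TopologicalSpace M] {S : Set M} {D : DilationAtlas M S} {α β ρ θ₀ : ℝ}

theorem ContainsCylinder.exists_isDilationQuotientMap (h : D.ContainsCylinder α β ρ)
    (θ₀ : ℝ) : ∃ Ψ : ℂ → M, D.IsDilationQuotientMap ρ (branchSector θ₀ α β) Ψ := by
  obtain ⟨-, hρ, ψ, ⟨hcont, hdil⟩, heq⟩ := h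
  have hlog : ContinuousOn (branchLog θ₀) (branchSector θ₀ α β) :=
    (continuousOn_branchLog θ₀).mono fun _ hz => hz.1
  have hmaps : MapsTo (branchLog θ₀) (branchSector θ₀ α β) (logSector α β) := fun _ hz => hz.2
  refine ⟨ψ ∘ branchLog θ₀, isOpen_branchSector θ₀ α β, ⟨hcont.comp hlog hmaps, fun z hz =>
    ⟨(hdil _ hz.2).1, fun e he hsrc => ?_⟩⟩, fun z hz z' hz' => ?_⟩
  · obtain ⟨a, b, ha, hev⟩ := (hdil _ hz.2).2 e he hsrc
    refine ⟨a, b, ha, ?_⟩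
    filter_upwards [((hlog z hz).tendsto_nhdsWithin hmaps).eventually hev, self_mem_nhdsWithin]
      with w hw hwmem
    rwa [exp_branchLog θ₀ (ne_zero_of_mem_branchSector hwmem)] at hw
  · simp only [Function.comp_apply, heq _ hz.2 _ hz'.2,
      branchLog_eq_add_int_mul_log_iff (one_pos.trans hρ) (ne_zero_of_mem_branchSector hz)
        (ne_zero_of_mem_branchSector hz')]

theorem ContainsCylinder.notMem_nonHyperbolicDirections
    {A : Matrix.SpecialLinearGroup (Fin 2) ℝ} (h : (D.sl2 A).ContainsCylinder α β ρ)
    (hθ₀ : θ₀ ∈ Ioo α β) {θ : Direction} {k : ℝ}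
    (hθ : planeHomeo A (unitVector θ) = k • Complex.exp (θ₀ * Complex.I)) :
    θ ∉ D.nonHyperbolicDirections := by
  obtain ⟨Ψ, hΨ⟩ := h.exists_isDilationQuotientMap θ₀
  refine hΨ.of_sl2.notMem_nonHyperbolicDirections h.2.1 (k := k)
    (v := (planeHomeo A).symm (Complex.exp (θ₀ * Complex.I))) (fun x hx => ?_)
    ((planeHomeo A).injective ?_)
  · rw [mem_preimage, planeHomeo_smul, Homeomorph.apply_symm_apply]
    exact smul_exp_mem_branchSector hθ₀ hx
  · rw [hθ, planeHomeo_smul, Homeomorph.apply_symm_apply]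

theorem exists_frequently_containsCylinder {ι : Type*} {l : Filter ι} {D : ι → DilationAtlas M S}
    (h : ¬ Tendsto (fun i => (D i).Theta) l (𝓝 0)) :
    ∃ δ : ℝ, 0 < δ ∧ ∃ᶠ i in l, ∃ α β ρ, (D i).ContainsCylinder α β ρ ∧ δ < β - α := by
  rw [ENNReal.tendsto_nhds_zero] at h
  push Not at h
  obtain ⟨δ, hδ, hfreq⟩ := h
  obtain ⟨δ', hδ', hlt⟩ := ENNReal.lt_iff_exists_nnreal_btwn.1 hδ
  refine ⟨δ', mod_cast hδ', hfreq.mono fun i hi => ?_⟩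
  have hΘ : (δ' : ENNReal) < (D i).Theta := hlt.trans hi
  simp only [Theta, lt_iSup_iff] at hΘ
  obtain ⟨α, β, ρ, hcyl, hangle⟩ := hΘ
  exact ⟨α, β, ρ, hcyl, by simpa using (ENNReal.lt_ofReal_iff_toReal_lt (by simp)).1 hangle⟩

end DilationAtlas

/-- The direction of the vector `w + i`. The parameter `w` is the slope measured from the vertical
direction, on which the Teichmüller flow acts by scaling. -/
noncomputable def slopeDirection (w : ℝ) : Direction :=
  ((Real.pi / 2 - Real.arctan w : ℝ) : Direction)

/-- The slopes, measured from the vertical direction, of the lines through `0` that meet the sector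
`logSector α β`. -/
def sectorSlopes (α β : ℝ) : Set ℝ :=
  {w | ∃ m : ℤ, Real.pi / 2 - Real.arctan w + m * Real.pi ∈ Ioo α β}

theorem unitVector_slopeDirection (w : ℝ) :
    unitVector (slopeDirection w) = Real.cos (Real.arctan w) • (w + Complex.I) := by
  rw [slopeDirection, unitVector_coe]
  apply Complex.ext
  · rw [Complex.exp_ofReal_mul_I_re, Real.cos_pi_div_two_sub, Real.sin_arctan, Real.cos_arctan]
    simp only [Complex.smul_re, Complex.add_re, Complex.ofReal_re, Complex.I_re, add_zero,
      smul_eq_mul]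
    ring
  · rw [Complex.exp_ofReal_mul_I_im, Real.sin_pi_div_two_sub]
    simp only [Complex.smul_im, Complex.add_im, Complex.ofReal_im, Complex.I_im, zero_add,
      smul_eq_mul, mul_one]

theorem planeHomeo_teichmullerMatrix_add_I (t w : ℝ) :
    planeHomeo (teichmullerMatrix t) ((Real.exp (-2 * t) * w : ℝ) + Complex.I) =
      Real.exp (-t) • (w + Complex.I) := by
  apply Complex.ext
  · have hexp : Real.exp t * Real.exp (-2 * t) = Real.exp (-t) := by
      rw [← Real.exp_add]
      ring_nf
    simp [planeHomeo, teichmullerMatrix, Complex.smul_re, ← mul_assoc, hexp, -Complex.real_smul,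
      -Complex.ofReal_mul, -Complex.ofReal_exp, -neg_mul]
  · simp [planeHomeo, teichmullerMatrix, Complex.smul_im, -Complex.real_smul,
      -Complex.ofReal_mul, -Complex.ofReal_exp]

theorem exists_planeHomeo_teichmullerMatrix_slopeDirection (t w : ℝ) :
    ∃ k : ℝ, planeHomeo (teichmullerMatrix t) (unitVector (slopeDirection (Real.exp (-2 * t) * w)))
      = k • unitVector (slopeDirection w) := by
  refine ⟨Real.cos (Real.arctan (Real.exp (-2 * t) * w)) * Real.exp (-t) *
    (Real.cos (Real.arctan w))⁻¹, ?_⟩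
  rw [unitVector_slopeDirection, unitVector_slopeDirection, planeHomeo_smul,
    planeHomeo_teichmullerMatrix_add_I, smul_smul, smul_smul,
    inv_mul_cancel_right₀ (Real.cos_arctan_pos w).ne']

theorem exp_add_int_mul_pi_mul_I (x : ℝ) (m : ℤ) :
    Complex.exp ((x + m * Real.pi : ℝ) * Complex.I) =
      (-1 : ℝ) ^ m • Complex.exp (x * Complex.I) := by
  apply Complex.ext <;>
    simp only [Complex.exp_ofReal_mul_I_re, Complex.exp_ofReal_mul_I_im, Complex.smul_re,
      Complex.smul_im, smul_eq_mul, Real.cos_add_int_mul_pi, Real.sin_add_int_mul_pi]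

theorem slopeDirection_notMem_nonHyperbolicDirections {M : Type*} [TopologicalSpace M] {S : Set M}
    {D : DilationAtlas M S} {t α β ρ w : ℝ} (h : (D.teichmullerFlow t).ContainsCylinder α β ρ)
    (hw : w ∈ sectorSlopes α β) :
    slopeDirection (Real.exp (-2 * t) * w) ∉ D.nonHyperbolicDirections := by
  obtain ⟨m, hm⟩ := hw
  obtain ⟨k, hk⟩ := exists_planeHomeo_teichmullerMatrix_slopeDirection t w
  have hsq : ((-1 : ℝ) ^ m) * (-1) ^ m = 1 := by rw [← mul_zpow]; simp
  refine h.notMem_nonHyperbolicDirections hm (k := k * (-1) ^ m) ?_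
  rw [hk, slopeDirection, unitVector_coe, exp_add_int_mul_pi_mul_I, smul_smul, mul_assoc, hsq,
    mul_one]

theorem lipschitzWith_arctan : LipschitzWith 1 Real.arctan := by
  refine lipschitzWith_of_nnnorm_deriv_le Real.differentiable_arctan fun x => ?_
  rw [← NNReal.coe_le_coe, coe_nnnorm, Real.deriv_arctan, Real.norm_of_nonneg (by positivity)]
  exact (div_le_one (by positivity)).2 (le_add_of_nonneg_right (sq_nonneg x))

theorem div_one_add_sq_le_arctan_sub_arctan {a b K : ℝ} (hab : a ≤ b) (ha : -K ≤ a) (hb : b ≤ K) :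
    (b - a) / (1 + K ^ 2) ≤ Real.arctan b - Real.arctan a := by
  have hderiv (x : ℝ) (hx : x ∈ interior (Icc (-K) K)) :
      (1 + K ^ 2)⁻¹ ≤ deriv Real.arctan x := by
    rw [interior_Icc] at hx
    simp only [Real.deriv_arctan, one_div]
    exact inv_anti₀ (by positivity) (by grw [sq_le_sq' hx.1.le hx.2.le])
  rw [div_eq_inv_mul]
  exact (convex_Icc (-K) K).mul_sub_le_image_sub_of_le_deriv Real.continuous_arctan.continuousOn
    Real.differentiable_arctan.differentiableOn hderiv a ⟨ha, hab.trans hb⟩ b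
    ⟨ha.trans hab, hb⟩ hab

theorem closedBall_coe_subset_image_coe_Icc (p c r : ℝ) :
    Metric.closedBall (c : AddCircle p) r ⊆ (↑) '' Icc (c - r) (c + r) := by
  intro z hz
  obtain ⟨x, rfl⟩ := QuotientAddGroup.mk_surjective z
  have hx : x ∈ ((↑) : ℝ → AddCircle p) ⁻¹' Metric.closedBall (c : AddCircle p) r := hz
  rw [AddCircle.coe_real_preimage_closedBall_eq_iUnion, mem_iUnion] at hx
  obtain ⟨m, hm⟩ := hx
  refine ⟨x - m • p, ?_, ?_⟩
  · rw [Real.closedBall_eq_Icc] at hm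
    constructor <;> linarith [hm.1, hm.2]
  · rw [AddCircle.coe_sub, AddCircle.coe_zsmul, AddCircle.coe_period, smul_zero, sub_zero]

theorem dist_slopeDirection_le (w : ℝ) :
    dist (slopeDirection w) ((Real.pi / 2 : ℝ) : Direction) ≤ |w| := by
  rw [slopeDirection, dist_eq_norm, ← AddCircle.coe_sub, sub_sub_cancel_left]
  refine QuotientAddGroup.norm_mk_le_norm.trans ?_
  simpa [Real.dist_eq] using lipschitzWith_arctan.dist_le_mul w 0

theorem exists_closedBall_subset_image_slopeDirection {a b K : ℝ} (hab : a ≤ b) (ha : -K ≤ a)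
    (hb : b ≤ K) : ∃ z : Direction,
      Metric.closedBall z ((b - a) / (2 * (1 + K ^ 2))) ⊆ slopeDirection '' Icc a b := by
  refine ⟨(Real.pi / 2 - (Real.arctan a + Real.arctan b) / 2 : ℝ),
    (closedBall_coe_subset_image_coe_Icc _ _ _).trans ?_⟩
  rintro _ ⟨x, hx, rfl⟩
  have hlen := div_one_add_sq_le_arctan_sub_arctan hab ha hb
  rw [mul_comm, ← div_div] at hx
  obtain ⟨w, hw, hwx⟩ := intermediate_value_Icc hab Real.continuous_arctan.continuousOn
    (show Real.pi / 2 - x ∈ Icc _ _ by constructor <;> linarith [hx.1, hx.2])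
  exact ⟨w, hw, by rw [slopeDirection, hwx, sub_sub_cancel]⟩

theorem exists_Icc_subset_Icc_add_int_mul_pi_subset_Ioo {α β h : ℝ} (hh : 0 < h)
    (hπ : 8 * h ≤ Real.pi) (hαβ : 8 * h ≤ β - α) :
    ∃ (m : ℤ) (c : ℝ), Icc (c - h) (c + h) ⊆ Icc h (Real.pi - h) ∧
      ∀ x ∈ Icc (c - h) (c + h), x + m * Real.pi ∈ Ioo α β := by
  obtain ⟨m, ⟨hm, hm'⟩, -⟩ := existsUnique_add_zsmul_mem_Ico Real.pi_pos α 0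
  rw [zsmul_eq_mul] at hm hm'
  rcases le_total (α + m * Real.pi) (Real.pi - 4 * h) with hfar | hnear
  · refine ⟨-m, α + m * Real.pi + 2 * h, fun x hx => ?_, fun x hx => ?_⟩ <;>
      push_cast <;> constructor <;> linarith [hx.1, hx.2]
  · refine ⟨1 - m, α + m * Real.pi - Real.pi + 6 * h, fun x hx => ?_, fun x hx => ?_⟩ <;>
      push_cast <;> constructor <;> linarith [hx.1, hx.2]

theorem exists_Icc_subset_inter_sectorSlopes {δ : ℝ} (hδ : 0 < δ) :
    ∃ K ℓ : ℝ, 0 < K ∧ 0 < ℓ ∧ ∀ α β, δ < β - α →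
      ∃ a b, a + ℓ ≤ b ∧ Icc a b ⊆ Ioo (-K) K ∩ sectorSlopes α β := by
  obtain ⟨h, hh, hδh, hπh⟩ : ∃ h, 0 < h ∧ 8 * h ≤ δ ∧ 8 * h ≤ Real.pi := by
    refine ⟨min (δ / 8) (Real.pi / 8), by positivity, ?_, ?_⟩
    · linarith [min_le_left (δ / 8) (Real.pi / 8)]
    · linarith [min_le_right (δ / 8) (Real.pi / 8)]
  have hrange {y : ℝ} (hy : y ∈ Ioo (-(Real.pi / 2)) (Real.pi / 2)) : ∃ w, Real.arctan w = y :=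
    Real.range_arctan.ge hy
  obtain ⟨K, hK⟩ := hrange (y := Real.pi / 2 - h / 2) (by constructor <;> linarith)
  refine ⟨K, 2 * h, Real.arctan_pos.1 (by linarith), by positivity, fun α β hαβ => ?_⟩
  obtain ⟨m, c, hc, hsector⟩ :=
    exists_Icc_subset_Icc_add_int_mul_pi_subset_Ioo hh hπh (hδh.trans hαβ.le)
  rw [Icc_subset_Icc_iff (by linarith)] at hc
  obtain ⟨a, ha⟩ := hrange (y := Real.pi / 2 - (c + h)) (by constructor <;> linarith)
  obtain ⟨b, hb⟩ := hrange (y := Real.pi / 2 - (c - h)) (by constructor <;> linarith)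
  refine ⟨a, b, ?_, fun w hw => ?_⟩
  · have hab : a ≤ b := Real.arctan_le_arctan_iff.1 (by linarith)
    have hdist := lipschitzWith_arctan.dist_le_mul b a
    rw [Real.dist_eq, Real.dist_eq, abs_of_nonneg (sub_nonneg.2 hab), NNReal.coe_one] at hdist
    linarith [le_abs_self (Real.arctan b - Real.arctan a)]
  · have haw := Real.arctan_mono hw.1
    have hwb := Real.arctan_mono hw.2
    refine ⟨⟨Real.arctan_lt_arctan_iff.1 ?_, Real.arctan_lt_arctan_iff.1 (by linarith)⟩, m,
      hsector _ (by constructor <;> linarith)⟩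
    rw [Real.arctan_neg]
    linarith

theorem exists_closedBall_subset_ball_diff_nonHyperbolicDirections {M : Type*}
    [TopologicalSpace M] {S : Set M} (D : DilationAtlas M S) {δ : ℝ} (hδ : 0 < δ) :
    ∃ K η : ℝ, 0 < K ∧ 0 < η ∧ ∀ t, 0 ≤ t → ∀ α β ρ, δ < β - α →
      (D.teichmullerFlow t).ContainsCylinder α β ρ → ∃ z : Direction,
        Metric.closedBall z (η * (Real.exp (-2 * t) * K)) ⊆
          Metric.ball ((Real.pi / 2 : ℝ) : Direction) (Real.exp (-2 * t) * K) \
            D.nonHyperbolicDirections := by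
  obtain ⟨K, ℓ, hK, hℓ, hslopes⟩ := exists_Icc_subset_inter_sectorSlopes hδ
  refine ⟨K, ℓ / (2 * (1 + K ^ 2) * K), hK, by positivity, fun t ht α β ρ hαβ hcyl => ?_⟩
  obtain ⟨a, b, hab, hsub⟩ := hslopes α β hαβ
  have hle : a ≤ b := by linarith
  have ha := (hsub (left_mem_Icc.2 hle)).1.1
  have hb := (hsub (right_mem_Icc.2 hle)).1.2
  set x := Real.exp (-2 * t)
  have hx : 0 < x := Real.exp_pos _
  have hx1 : x ≤ 1 := Real.exp_le_one_iff.2 (by linarith)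
  obtain ⟨z, hz⟩ := exists_closedBall_subset_image_slopeDirection (K := K)
    (mul_le_mul_of_nonneg_left hle hx.le) (by nlinarith) (by nlinarith)
  have hradius : ℓ / (2 * (1 + K ^ 2) * K) * (x * K) ≤
      (x * b - x * a) / (2 * (1 + K ^ 2)) := by
    rw [← mul_sub, show ℓ / (2 * (1 + K ^ 2) * K) * (x * K) = x * ℓ / (2 * (1 + K ^ 2)) by
      field_simp]
    gcongr
    linarith
  refine ⟨z, (Metric.closedBall_subset_closedBall hradius).trans (hz.trans ?_)⟩
  rw [← image_mul_left_Icc hx.le hle]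
  rintro _ ⟨_, ⟨w, hw, rfl⟩, rfl⟩
  obtain ⟨⟨hlow, hup⟩, hsector⟩ := hsub hw
  refine ⟨(dist_slopeDirection_le _).trans_lt ?_,
    slopeDirection_notMem_nonHyperbolicDirections hcyl hsector⟩
  rw [abs_mul, abs_of_pos hx]
  exact mul_lt_mul_of_pos_left (abs_lt.2 ⟨hlow, hup⟩) hx

theorem measureReal_closedBall_addCircle {T : ℝ} [Fact (0 < T)] (x : AddCircle T) {r : ℝ}
    (hr : 0 ≤ r) (hT : 2 * r ≤ T) : volume.real (Metric.closedBall x r) = 2 * r := by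
  rw [measureReal_def, AddCircle.volume_closedBall, min_eq_right hT,
    ENNReal.toReal_ofReal (by positivity)]

theorem measureReal_ball_addCircle {T : ℝ} [Fact (0 < T)] (x : AddCircle T) {r : ℝ}
    (hr : 0 ≤ r) (hT : 2 * r ≤ T) : volume.real (Metric.ball x r) = 2 * r := by
  rw [← measureReal_congr AddCircle.closedBall_ae_eq_ball, measureReal_closedBall_addCircle x hr hT]

theorem measureReal_inter_le_of_closedBall_subset_diff {T : ℝ} [Fact (0 < T)]
    {A B : Set (AddCircle T)} {z : AddCircle T} {s : ℝ} (hs : 0 ≤ s) (hsT : 2 * s ≤ T)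
    (h : Metric.closedBall z s ⊆ B \ A) : volume.real (A ∩ B) ≤ volume.real B - 2 * s := by
  have hsub : A ∩ B ⊆ B \ Metric.closedBall z s := fun y hy => ⟨hy.2, fun hyz => (h hyz).2 hy.1⟩
  refine (measureReal_mono hsub).trans_eq ?_
  rw [measureReal_sdiff (h.trans sdiff_subset) Metric.isClosed_closedBall.measurableSet,
    measureReal_closedBall_addCircle z hs hsT]

theorem not_isDensityPoint_of_frequently {A : Set Direction} {x : Direction} {η : ℝ} (hη : 0 < η)
    (h : ∃ᶠ r in 𝓝[>] (0 : ℝ), ∃ z : Direction,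
      Metric.closedBall z (η * r) ⊆ Metric.ball x r \ A) : ¬ IsDensityPoint A x := by
  intro hdensity
  have hratio : ∀ᶠ r in 𝓝[>] (0 : ℝ), 1 - η <
      (volume (A ∩ Metric.ball x r) / volume (Metric.ball x r)).toReal :=
    ((ENNReal.tendsto_toReal ENNReal.one_ne_top).comp hdensity).eventually
      (eventually_gt_nhds (by simpa using hη))
  have hsmall : ∀ᶠ r in 𝓝[>] (0 : ℝ), r < Real.pi ∧ η * r < Real.pi :=
    nhdsWithin_le_nhds ((eventually_lt_nhds Real.pi_pos).and
      ((Continuous.tendsto' (by fun_prop) 0 0 (by simp)).eventually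
        (eventually_lt_nhds Real.pi_pos)))
  obtain ⟨r, ⟨z, hz⟩, hr, ⟨hrπ, hηrπ⟩, hr0⟩ :=
    (h.and_eventually (hratio.and (hsmall.and self_mem_nhdsWithin))).exists
  have hr0 : 0 < r := hr0
  have hle := measureReal_inter_le_of_closedBall_subset_diff (by positivity) (by linarith) hz
  rw [measureReal_ball_addCircle x hr0.le (by linarith)] at hle
  rw [ENNReal.toReal_div, ← measureReal_def, ← measureReal_def,
    measureReal_ball_addCircle x hr0.le (by linarith), lt_div_iff₀ (by positivity)] at hr
  linarith

end Dilation

theorem mainTheorem8_general {M : Type*} [TopologicalSpace M] {S : Set M}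
    (D : Dilation.DilationAtlas M S)
    (hΘ : ¬ Tendsto (fun t : ℝ => (D.teichmullerFlow t).Theta) atTop (𝓝 0)) :
    ¬ Dilation.IsDensityPoint D.nonHyperbolicDirections
      ((Real.pi / 2 : ℝ) : Dilation.Direction) := by
  obtain ⟨δ, hδ, hfreq⟩ := Dilation.DilationAtlas.exists_frequently_containsCylinder hΘ
  obtain ⟨K, η, hK, hη, harc⟩ :=
    Dilation.exists_closedBall_subset_ball_diff_nonHyperbolicDirections D hδ
  have hradius : Tendsto (fun t : ℝ => Real.exp (-2 * t) * K) atTop (𝓝[>] 0) := by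
    refine tendsto_nhdsWithin_iff.2 ⟨?_, Eventually.of_forall fun t => mul_pos (Real.exp_pos _) hK⟩
    have hexp : Tendsto (fun t : ℝ => Real.exp (-2 * t)) atTop (𝓝 0) :=
      Real.tendsto_exp_atBot.comp (tendsto_id.const_mul_atTop_of_neg (by norm_num))
    simpa using hexp.mul_const K
  refine Dilation.not_isDensityPoint_of_frequently hη (hradius.frequently ?_)
  refine (hfreq.and_eventually (eventually_ge_atTop 0)).mono ?_
  rintro t ⟨⟨α, β, ρ, hcyl, hangle⟩, ht⟩
  exact harc t ht α β ρ hangle hcyl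

theorem mainTheorem8 {M : Type*} [TopologicalSpace M] [T2Space M] [CompactSpace M]
    [ConnectedSpace M] [ChartedSpace (EuclideanSpace ℝ (Fin 2)) M]
    (g n : ℕ) (p : Fin n → M) (D : Dilation.DilationAtlas M (Set.range p))
    (hD : Dilation.RepresentsMD g n p D)
    (hΘ : ¬ Tendsto (fun t : ℝ => (D.teichmullerFlow t).Theta) atTop (𝓝 0)) :
    ¬ Dilation.IsDensityPoint D.nonHyperbolicDirections
      ((Real.pi / 2 : ℝ) : Dilation.Direction) :=
  mainTheorem8_general D hΘ
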